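/- Let $d\ge 1$ and let $ID_0=ID_0(\mathbb R^d)$ be the class of infinitely divisible probability distributions on $\mathbb R^d$ without Gaussian part. For $\mu\in ID_0$ let $\nu_\mu$ (the Lévy measure, satisfying $\nu_\mu(\{0\})=0$ and $\int(|x|^2\wedge 1)\,\nu_\mu(dx)<\infty$) and $\gamma_\mu\in\mathbb R^d$ be determined by the Lévy–Khintchine representation $$\widehat\mu(z)=\exp\Bigl[\int_{\mathbb R^d}\bigl(e^{i\langle z,x\rangle}-1-i\langle z,x\rangle 1_{\{|x|\le 1\}}(x)\bigr)\nu_\mu(dx)+i\langle\gamma_\mu,z\rangle\Bigr],\quad z\in\mathbb R^d.$$ If $\int_{|x|\le 1}|x|\,\nu_\mu(dx)<\infty$, the drift $\gamma^0_\mu$ of $\mu$ is the vector with $\widehat\mu(z)=\exp\bigl[\int(e^{i\langle z,x\rangle}-1)\,\nu_\mu(dx)+i\langle\gamma^0_\mu,z\rangle\bigr]$ for all $z$. If $\int|x|\,\mu(dx)<\infty$, the mean of $\mu$ is $m_\mu=\int x\,\mu(dx)$. Let $ID_{0c}$ be the class of $\mu\in ID_0$ such that $\nu_\mu(\{|x|<a^{-1}\})=\nu_\mu(\{|x|>a\})=0$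 for some $a>1$. Let $\iota(x)=|x|^{-2}x$ for $x\ne 0$. The inversion of $\mu\in ID_0$ is the distribution $\mu'\in ID_0$ with $$\nu_{\mu'}(B)=\int_{\mathbb R^d\setminus\{0\}}1_B(\iota(x))\,|x|^2\,\nu_\mu(dx)\ \text{ for all Borel sets } B\subset\mathbb R^d,\qquad \gamma_{\mu'}=-\gamma_\mu+\int_{|x|=1}x\,\nu_\mu(dx).$$ Suppose that $\mu\mapsto\mu^\sharp$ is a mapping from $ID_0$ into $ID_0$ and $k\in\mathbb R$ is such that 1. $\nu_{\mu^\sharp}(B)=\int_{\mathbb R^d\setminus\{0\}}1_B(\iota(x))\,|x|^2\,\nu_\mu(dx)$ for all $\mu\in ID_0$ and all Borel sets $B\subset\mathbb R^d$; 2. $\mu^{\sharp\sharp}=\mu$ for all $\mu\in ID_0$; 3. for all $\mu\in ID_{0c}$, $\mu^\sharp$ has drift $\gamma^0_{\mu^\sharp}=k\,m_\mu$; 4. if $\mu,\mu_1,\mu_2,\ldots\in ID_0$ and $\mu_n\to\mu$ weakly, then $\mu_n^\sharp\to\mu^\sharp$ weakly. Then $k=-1$ and $\mu^\sharp=\mu'$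 for all $\mu\in ID_0$. -/

import Mathlib

open MeasureTheory Filter Topology

/-- `ℝ^d` with its Euclidean norm. -/
abbrev Euc (d : ℕ) : Type := EuclideanSpace ℝ (Fin d)

/-- The `n`-fold convolution `μ ∗ ⋯ ∗ μ` (with `δ₀` for `n = 0`). -/
noncomputable def convPower {d : ℕ} (μ : Measure (Euc d)) : ℕ → Measure (Euc d)
  | 0 => Measure.dirac 0
  | n + 1 => (convPower μ n).conv μ

/-- `μ` is infinitely divisible: it has an `n`-th convolution root for every `n ≥ 1`. -/
def IsInfinitelyDivisible {d : ℕ} (μ : ProbabilityMeasure (Euc d)) : Prop :=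
  ∀ n : ℕ, 1 ≤ n → ∃ ρ : ProbabilityMeasure (Euc d),
    convPower (ρ : Measure (Euc d)) n = (μ : Measure (Euc d))

/-- `ν` is a Lévy measure: `ν({0}) = 0` and `∫ (|x|² ∧ 1) ν(dx) < ∞`. -/
def IsLevyMeasure {d : ℕ} (ν : Measure (Euc d)) : Prop :=
  ν {0} = 0 ∧ ∫⁻ x, ENNReal.ofReal (min (‖x‖ ^ 2) 1) ∂ν < ⊤

/-- The integrand `e^{i⟨z,x⟩} - 1 - i⟨z,x⟩ 1_{|x| ≤ 1}(x)` of the Lévy–Khintchine formula. -/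
noncomputable def levyIntegrand {d : ℕ} (z x : Euc d) : ℂ :=
  Complex.exp (Complex.I * (inner ℝ z x : ℝ)) - 1
    - Complex.I * (inner ℝ z x : ℝ) * Set.indicator {y : Euc d | ‖y‖ ≤ 1} (fun _ => (1 : ℂ)) x

/-- `(A, ν, γ)` is the Lévy–Khintchine triplet of `μ` (Gaussian covariance matrix, Lévy measure,
location parameter). -/
def HasTriplet {d : ℕ} (μ : ProbabilityMeasure (Euc d)) (A : Matrix (Fin d) (Fin d) ℝ)
    (ν : Measure (Euc d)) (γ : Euc d) : Prop :=
  A.PosSemidef ∧ IsLevyMeasure ν ∧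
    ∀ z : Euc d, charFun (μ : Measure (Euc d)) z =
      Complex.exp (-(1 / 2) * ((z.ofLp ⬝ᵥ A.mulVec z.ofLp : ℝ) : ℂ)
        + ∫ x, levyIntegrand z x ∂ν + Complex.I * (inner ℝ γ z : ℝ))

/-- `ID₀(ℝ^d)`: the infinitely divisible distributions on `ℝ^d` without Gaussian part. -/
def ID0 (d : ℕ) : Set (ProbabilityMeasure (Euc d)) :=
  {μ | IsInfinitelyDivisible μ ∧ ∃ ν γ, HasTriplet μ 0 ν γ}

/-- `ν` is carried by a compact annulus in `ℝ^d \ {0}`. -/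
def SupportedInAnnulus {d : ℕ} (ν : Measure (Euc d)) : Prop :=
  ∃ a : ℝ, 1 < a ∧ ν {x | ‖x‖ < a⁻¹} = 0 ∧ ν {x | a < ‖x‖} = 0

/-- `ID₀c(ℝ^d)`: those `μ ∈ ID₀(ℝ^d)` whose Lévy measure has compact support in `ℝ^d \ {0}`. -/
def ID0c (d : ℕ) : Set (ProbabilityMeasure (Euc d)) :=
  {μ | μ ∈ ID0 d ∧ ∃ ν γ, HasTriplet μ 0 ν γ ∧ SupportedInAnnulus ν}

/-- `c` is the drift of `μ ∈ ID₀`: its Lévy measure `ν` satisfies `∫_{|x| ≤ 1} |x| ν(dx) < ∞` and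
`μ̂(z) = exp(∫ (e^{i⟨z,x⟩} - 1) ν(dx) + i⟨c,z⟩)`. -/
def HasDrift {d : ℕ} (μ : ID0 d) (c : Euc d) : Prop :=
  ∃ ν : Measure (Euc d), IsLevyMeasure ν ∧
    ∫⁻ x in {x : Euc d | ‖x‖ ≤ 1}, ENNReal.ofReal ‖x‖ ∂ν < ⊤ ∧
    ∀ z : Euc d, charFun (μ.1 : Measure (Euc d)) z =
      Complex.exp (∫ x, (Complex.exp (Complex.I * (inner ℝ z x : ℝ)) - 1) ∂ν
        + Complex.I * (inner ℝ c z : ℝ))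

/-- `c` is the mean of `μ`. -/
def HasMean {d : ℕ} (μ : ProbabilityMeasure (Euc d)) (c : Euc d) : Prop :=
  Integrable (fun x : Euc d => x) (μ : Measure (Euc d)) ∧ ∫ x, x ∂(μ : Measure (Euc d)) = c

/-- The geometric inversion `ι(x) = |x|⁻² x` of a point `x ≠ 0`. -/
noncomputable def geomInv {d : ℕ} (x : Euc d) : Euc d := (‖x‖ ^ 2)⁻¹ • x

/-- `ν'(B) = ∫_{ℝ^d \ {0}} 1_B(ι(x)) |x|² ν(dx)` for all Borel sets `B`. -/
def IsInvertedMeasure {d : ℕ} (ν ν' : Measure (Euc d)) : Prop :=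
  ∀ B : Set (Euc d), MeasurableSet B →
    ν' B = ∫⁻ x in ({0}ᶜ : Set (Euc d)),
      B.indicator (fun _ => (1 : ENNReal)) (geomInv x) * ENNReal.ofReal (‖x‖ ^ 2) ∂ν

/-- `ρ` is the inversion `μ'` of `μ`: `ν_ρ(B) = ∫_{x ≠ 0} 1_B(ι(x)) |x|² ν_μ(dx)` for Borel `B`,
and `γ_ρ = -γ_μ + ∫_{|x| = 1} x ν_μ(dx)`. Triplets of elements of `ID₀` exist by definition
and are unique. -/
def IsInversion {d : ℕ} (μ ρ : ID0 d) : Prop :=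
  ∀ (ν ν' : Measure (Euc d)) (γ γ' : Euc d), HasTriplet μ.1 0 ν γ → HasTriplet ρ.1 0 ν' γ' →
    IsInvertedMeasure ν ν' ∧ γ' = -γ + ∫ x in {x : Euc d | ‖x‖ = 1}, x ∂ν

/-! If `ν` is finite and lives on an annulus, the law with Lévy measure `ν` and drift `c` is a
shifted compound Poisson law with mean `c + ∫ x dν`. So conditions 1 and 3 force `sharp` to act by
`(ν, c) ↦ (invMeasure ν, k • (c + ∫ x dν))` (`hasDriftRep_sharp`). Applying this twice to the
self-inverse measures `0` and `δ_e`, `|e| = 1`, involutivity gives `k² = 1` and `k (k + 1) = 0`,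
hence `k = -1`.

With `k = -1`, passing from drift to location yields `γ' = -γ + ∫_{|x|=1} x dν` on annuli. For
general `μ`, truncate `ν` to annuli stable under inversion and keep `γ` fixed: the laws converge
weakly to `μ`, their images all have the same location, and condition 4 carries the formula to the
limit (`location_sharp`). Lévy measure and location determine the law. -/

/-! ### Convolution powers: mass, characteristic function, first moment. -/

section ConvPower

variable {d : ℕ}

instance isFiniteMeasure_convPower (ν : Measure (Euc d)) [IsFiniteMeasure ν] (n : ℕ) :
    IsFiniteMeasure (convPower ν n) := by
  induction n with
  | zero => exact inferInstanceAs (IsFiniteMeasure (Measure.dirac 0))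
  | succ n ih => exact inferInstanceAs (IsFiniteMeasure ((convPower ν n).conv ν))

lemma charFun_convPower (ν : Measure (Euc d)) [IsFiniteMeasure ν] (n : ℕ) (z : Euc d) :
    charFun (convPower ν n) z = charFun ν z ^ n := by
  induction n with
  | zero => simp [convPower, charFun_dirac]
  | succ n ih => rw [convPower, charFun_conv, ih, pow_succ]

lemma convPower_univ (ν : Measure (Euc d)) [IsFiniteMeasure ν] (n : ℕ) :
    convPower ν n Set.univ = ν Set.univ ^ n := by
  induction n with
  | zero => simp [convPower]
  | succ n ih =>
    rw [convPower, Measure.conv, Measure.map_apply (by fun_prop) .univ, Set.preimage_univ,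
      ← Set.univ_prod_univ, Measure.prod_prod, ih, pow_succ]

lemma lintegral_enorm_convPower_succ_le (ν : Measure (Euc d)) [IsFiniteMeasure ν] (n : ℕ) :
    ∫⁻ x, ‖x‖ₑ ∂(convPower ν (n + 1)) ≤ (n + 1) * ν Set.univ ^ n * ∫⁻ x, ‖x‖ₑ ∂ν := by
  induction n with
  | zero => simp [convPower]
  | succ n ih =>
    rw [convPower, Measure.lintegral_conv (by fun_prop)]
    calc ∫⁻ x, ∫⁻ y, ‖x + y‖ₑ ∂ν ∂(convPower ν (n + 1))
        ≤ ∫⁻ x, ∫⁻ y, (‖x‖ₑ + ‖y‖ₑ) ∂ν ∂(convPower ν (n + 1)) := by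
          gcongr with x y
          exact enorm_add_le x y
      _ = (∫⁻ x, ‖x‖ₑ ∂(convPower ν (n + 1))) * ν Set.univ
            + (∫⁻ x, ‖x‖ₑ ∂ν) * ν Set.univ ^ (n + 1) := by
          simp_rw [lintegral_add_left (measurable_const), lintegral_const]
          rw [lintegral_add_left (by fun_prop), lintegral_mul_const _ (by fun_prop),
            lintegral_const, convPower_univ]
      _ ≤ ((n + 1) * ν Set.univ ^ n * ∫⁻ x, ‖x‖ₑ ∂ν) * ν Set.univ
            + (∫⁻ x, ‖x‖ₑ ∂ν) * ν Set.univ ^ (n + 1) := by gcongr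
      _ = _ := by push_cast; ring

lemma integrable_convPower {ν : Measure (Euc d)} [IsFiniteMeasure ν]
    (h : Integrable (fun x : Euc d => x) ν) (n : ℕ) :
    Integrable (fun x : Euc d => x) (convPower ν n) := by
  cases n with
  | zero => exact integrable_dirac (by simp)
  | succ n =>
    refine ⟨by fun_prop, (lintegral_enorm_convPower_succ_le ν n).trans_lt ?_⟩
    exact ENNReal.mul_lt_top (ENNReal.mul_lt_top (by simp) (by simp)) h.2

lemma integral_convPower_succ {ν : Measure (Euc d)} [IsFiniteMeasure ν]
    (h : Integrable (fun x : Euc d => x) ν) (n : ℕ) :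
    ∫ x, x ∂(convPower ν (n + 1)) = ((n + 1) * ν.real Set.univ ^ n) • ∫ x, x ∂ν := by
  induction n with
  | zero => simp [convPower]
  | succ n ih =>
    have hi := integrable_convPower h (n + 1 + 1)
    rw [convPower] at hi ⊢
    rw [integral_conv hi]
    have hn := integrable_convPower h (n + 1)
    have hu : (convPower ν (n + 1)).real Set.univ = ν.real Set.univ ^ (n + 1) := by
      simp [measureReal_def, convPower_univ]
    have e : ∀ x : Euc d, ∫ y, (x + y) ∂ν = ν.real Set.univ • x + ∫ y, y ∂ν := fun x => by
      rw [integral_add (integrable_const _) h, integral_const]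
    simp_rw [e]
    have hs : Integrable (fun x : Euc d => ν.real Set.univ • x) (convPower ν (n + 1)) :=
      hn.fun_smul (ν.real Set.univ)
    rw [integral_add hs (integrable_const _), integral_smul, integral_const, ih, hu,
      smul_smul, ← add_smul]
    congr 1
    push_cast
    ring

end ConvPower

/-! ### Compound Poisson laws and their mean. -/

section CompoundPoisson

variable {d : ℕ}

/-- The compound Poisson distribution `e^{-ν(ℝ^d)} ∑ ν^{*k} / k!` of a finite measure `ν`. -/
noncomputable def compoundPoisson (ν : Measure (Euc d)) : Measure (Euc d) :=
  Measure.sum fun k : ℕ =>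
    ENNReal.ofReal (Real.exp (-ν.real Set.univ) / k.factorial) • convPower ν k

lemma compoundPoisson_univ (ν : Measure (Euc d)) [IsFiniteMeasure ν] :
    compoundPoisson ν Set.univ = 1 := by
  have h : HasSum (fun k : ℕ => Real.exp (-ν.real Set.univ) / k.factorial * ν.real Set.univ ^ k)
      1 := by
    have := (NormedSpace.expSeries_div_hasSum_exp (ν.real Set.univ)).mul_left
      (Real.exp (-ν.real Set.univ))
    rw [← Real.exp_eq_exp_ℝ, ← Real.exp_add, neg_add_cancel, Real.exp_zero] at this
    exact this.congr_fun fun k => by ring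
  rw [compoundPoisson, Measure.sum_apply _ .univ]
  simp only [Measure.smul_apply, smul_eq_mul, convPower_univ]
  have e : ∀ k : ℕ, ENNReal.ofReal (Real.exp (-ν.real Set.univ) / k.factorial) * ν Set.univ ^ k
      = ENNReal.ofReal (Real.exp (-ν.real Set.univ) / k.factorial * ν.real Set.univ ^ k) := by
    intro k
    rw [ENNReal.ofReal_mul (by positivity), ENNReal.ofReal_pow (by positivity), ofReal_measureReal]
  simp_rw [e]
  rw [← ENNReal.ofReal_tsum_of_nonneg (fun k => by positivity) h.summable, h.tsum_eq,
    ENNReal.ofReal_one]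

instance isProbabilityMeasure_compoundPoisson (ν : Measure (Euc d)) [IsFiniteMeasure ν] :
    IsProbabilityMeasure (compoundPoisson ν) := ⟨compoundPoisson_univ ν⟩

lemma charFun_compoundPoisson (ν : Measure (Euc d)) [IsFiniteMeasure ν] (z : Euc d) :
    charFun (compoundPoisson ν) z = Complex.exp (charFun ν z - ν.real Set.univ) := by
  have hint : Integrable (fun x : Euc d => Complex.exp ((inner ℝ x z : ℝ) * Complex.I))
      (compoundPoisson ν) :=
    (integrable_const (1 : ℝ)).mono (by fun_prop) (by simp [Complex.norm_exp_ofReal_mul_I])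
  have h1 := hasSum_integral_measure (μ := fun k : ℕ =>
    ENNReal.ofReal (Real.exp (-ν.real Set.univ) / k.factorial) • convPower ν k) hint
  have h2 := (NormedSpace.expSeries_div_hasSum_exp (charFun ν z)).mul_left
    (Complex.exp (-ν.real Set.univ))
  rw [← Complex.exp_eq_exp_ℂ, ← Complex.exp_add, neg_add_eq_sub] at h2
  refine HasSum.unique (h1.congr_fun ?_) h2 
  intro k
  rw [integral_smul_measure, ENNReal.toReal_ofReal (by positivity), ← charFun_apply,
    charFun_convPower, Complex.real_smul]
  push_cast
  ring

/-- The first absolute moment of the `(n+1)`-st power is at most `(n+1) m^n ∫ |x| dν`, where `m` is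
the total mass; dividing by `(n+1)!` leaves a multiple of the exponential series. -/
lemma integrable_compoundPoisson {ν : Measure (Euc d)} [IsFiniteMeasure ν]
    (h : Integrable (fun x : Euc d => x) ν) :
    Integrable (fun x : Euc d => x) (compoundPoisson ν) := by
  refine ⟨by fun_prop, ?_⟩
  rw [hasFiniteIntegral_iff_enorm, compoundPoisson, lintegral_sum_measure]
  simp_rw [lintegral_smul_measure]
  rw [tsum_eq_zero_add' ENNReal.summable]
  simp only [convPower, lintegral_dirac, enorm_zero, smul_zero, zero_add]
  have hs := (Real.summable_pow_div_factorial (ν.real Set.univ)).mul_left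
    (Real.exp (-ν.real Set.univ))
  have hM : ∫⁻ x, ‖x‖ₑ ∂ν < ⊤ := h.2
  have hle : ∀ n : ℕ, ENNReal.ofReal (Real.exp (-ν.real Set.univ) / (n + 1).factorial) •
      ∫⁻ x, ‖x‖ₑ ∂(convPower ν (n + 1)) ≤
      ENNReal.ofReal (Real.exp (-ν.real Set.univ) * (ν.real Set.univ ^ n / n.factorial)) *
        ∫⁻ x, ‖x‖ₑ ∂ν := by
    intro n
    refine (mul_le_mul_right (lintegral_enorm_convPower_succ_le ν n) _).trans (le_of_eq ?_)
    rw [← mul_assoc, ← ofReal_measureReal (μ := ν), ← ENNReal.ofReal_pow (by positivity),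
      show ((n : ENNReal) + 1) = ENNReal.ofReal (n + 1) by
        rw [ENNReal.ofReal_add (by positivity) (by positivity)]; simp,
      ← ENNReal.ofReal_mul (by positivity), ← ENNReal.ofReal_mul (by positivity)]
    congr 2
    rw [Nat.factorial_succ]
    push_cast
    field_simp
  refine (ENNReal.tsum_le_tsum hle).trans_lt ?_
  rw [ENNReal.tsum_mul_right, ← ENNReal.ofReal_tsum_of_nonneg (fun n => by positivity) hs]
  exact ENNReal.mul_lt_top ENNReal.ofReal_lt_top hM

lemma integral_compoundPoisson {ν : Measure (Euc d)} [IsFiniteMeasure ν]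
    (h : Integrable (fun x : Euc d => x) ν) :
    ∫ x, x ∂(compoundPoisson ν) = ∫ x, x ∂ν := by
  have h1 := hasSum_integral_measure (μ := fun k : ℕ =>
    ENNReal.ofReal (Real.exp (-ν.real Set.univ) / k.factorial) • convPower ν k) 
    (integrable_compoundPoisson h)
  refine h1.unique ?_
  -- The zeroth power is `δ₀`, with mean zero; dropping it turns `(k+1)/(k+1)!` into `1/k!`.
  rw [← hasSum_nat_add_iff' 1]
  have h2 := (NormedSpace.expSeries_div_hasSum_exp (ν.real Set.univ)).mul_left
    (Real.exp (-ν.real Set.univ))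
  rw [← Real.exp_eq_exp_ℝ, ← Real.exp_add, neg_add_cancel, Real.exp_zero] at h2
  have h3 := h2.smul_const (∫ x, x ∂ν)
  simp only [Finset.range_one, Finset.sum_singleton, integral_smul_measure, convPower,
    integral_dirac, smul_zero, sub_zero]
  rw [one_smul] at h3
  refine h3.congr_fun fun k => ?_
  have h4 := integral_convPower_succ h k
  rw [convPower] at h4
  rw [h4, smul_smul, ENNReal.toReal_ofReal (by positivity)]
  congr 1
  rw [Nat.factorial_succ]
  push_cast
  field_simp

end CompoundPoisson

/-! ### Laws with finite Lévy measure and prescribed drift. -/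

section Drift

variable {d : ℕ}

/-- The characteristic function of `μ` is `z ↦ exp (∫ (e^{i⟨z,x⟩} - 1) ν(dx) + i⟨c,z⟩)`. -/
def HasDriftRep (μ : Measure (Euc d)) (ν : Measure (Euc d)) (c : Euc d) : Prop :=
  ∀ z : Euc d, charFun μ z =
    Complex.exp (∫ x, (Complex.exp (Complex.I * (inner ℝ z x : ℝ)) - 1) ∂ν
      + Complex.I * (inner ℝ c z : ℝ))

/-- The compound Poisson distribution of `ν` translated by `c`. -/
noncomputable def shiftedCompoundPoisson (ν : Measure (Euc d)) (c : Euc d) : Measure (Euc d) :=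
  (compoundPoisson ν).map (· + c)

instance isProbabilityMeasure_shiftedCompoundPoisson (ν : Measure (Euc d)) [IsFiniteMeasure ν]
    (c : Euc d) : IsProbabilityMeasure (shiftedCompoundPoisson ν c) :=
  Measure.isProbabilityMeasure_map (by fun_prop)

lemma integral_exp_inner_sub_one (ν : Measure (Euc d)) [IsFiniteMeasure ν] (z : Euc d) :
    ∫ x, (Complex.exp (Complex.I * (inner ℝ z x : ℝ)) - 1) ∂ν
      = charFun ν z - ν.real Set.univ := by
  have hi : Integrable (fun x : Euc d => Complex.exp (Complex.I * (inner ℝ z x : ℝ))) ν :=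
    (integrable_const (1 : ℝ)).mono (by fun_prop) (by simp [Complex.norm_exp_I_mul_ofReal])
  rw [integral_sub hi (integrable_const _), integral_const, charFun_apply]
  simp [mul_comm, real_inner_comm]

lemma hasDriftRep_shiftedCompoundPoisson (ν : Measure (Euc d)) [IsFiniteMeasure ν] (c : Euc d) :
    HasDriftRep (shiftedCompoundPoisson ν c) ν c := by
  intro z
  rw [shiftedCompoundPoisson, charFun_map_add_const, charFun_compoundPoisson,
    integral_exp_inner_sub_one, ← Complex.exp_add, mul_comm Complex.I]

lemma HasDriftRep.measure_eq {μ μ' ν : Measure (Euc d)} [IsFiniteMeasure μ] [IsFiniteMeasure μ']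
    {c : Euc d} (h : HasDriftRep μ ν c) (h' : HasDriftRep μ' ν c) : μ = μ' :=
  Measure.ext_of_charFun (funext fun z => (h z).trans (h' z).symm)

lemma isInfinitelyDivisible_shiftedCompoundPoisson (ν : Measure (Euc d)) [IsFiniteMeasure ν]
    (c : Euc d) : IsInfinitelyDivisible ⟨shiftedCompoundPoisson ν c, inferInstance⟩ := by
  intro n hn
  have hn' : (n : ℂ) ≠ 0 := by exact_mod_cast (by omega : n ≠ 0)
  -- The exponent is linear in `(ν, c)`, so dividing both by `n` gives an `n`-th root.
  refine ⟨⟨shiftedCompoundPoisson ((n : NNReal)⁻¹ • ν) ((n : ℝ)⁻¹ • c), inferInstance⟩, ?_⟩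
  change convPower (shiftedCompoundPoisson ((n : NNReal)⁻¹ • ν) ((n : ℝ)⁻¹ • c)) n
    = shiftedCompoundPoisson ν c
  refine Measure.ext_of_charFun (funext fun z => ?_)
  rw [charFun_convPower, hasDriftRep_shiftedCompoundPoisson, hasDriftRep_shiftedCompoundPoisson,
    ← Complex.exp_nat_mul, integral_smul_nnreal_measure, real_inner_smul_left, NNReal.smul_def,
    Complex.real_smul]
  congr 1
  push_cast
  field_simp

lemma hasMean_shiftedCompoundPoisson {ν : Measure (Euc d)} [IsFiniteMeasure ν] (c : Euc d)
    (h : Integrable (fun x : Euc d => x) ν) :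
    HasMean ⟨shiftedCompoundPoisson ν c, inferInstance⟩ (c + ∫ x, x ∂ν) := by
  have hi := integrable_compoundPoisson h
  refine ⟨(integrable_map_measure (by fun_prop) (by fun_prop)).2
    (hi.add (integrable_const c)), ?_⟩
  simp only [ProbabilityMeasure.coe_mk, shiftedCompoundPoisson]
  rw [integral_map (by fun_prop) (by fun_prop), integral_add hi (integrable_const c),
    integral_compoundPoisson h, add_comm]
  simp

end Drift

/-! ### The Lévy–Khintchine integrand; drift versus location. -/

section LevyIntegrand

variable {d : ℕ}

lemma Complex.norm_exp_I_mul_sub_one_sub_le (t : ℝ) :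
    ‖Complex.exp (Complex.I * t) - 1 - Complex.I * t‖ ≤ 3 * t ^ 2 := by
  have hn : ‖Complex.I * (t : ℂ)‖ = |t| := by simp
  rcases le_or_gt |t| 1 with h | h
  · have := Complex.norm_exp_sub_one_sub_id_le (x := Complex.I * t) (hn ▸ h)
    rw [hn, sq_abs] at this
    nlinarith [sq_nonneg t]
  · have h1 : ‖Complex.exp (Complex.I * t) - 1‖ ≤ |t| := Real.norm_exp_I_mul_ofReal_sub_one_le
    have h2 := norm_sub_le (Complex.exp (Complex.I * t) - 1) (Complex.I * t)
    rw [hn] at h2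
    nlinarith [sq_abs t]

lemma measurable_levyIntegrand (z : Euc d) : Measurable (levyIntegrand z) := by
  have hs : MeasurableSet {y : Euc d | ‖y‖ ≤ 1} := measurableSet_le (by fun_prop) (by fun_prop)
  unfold levyIntegrand
  have : Measurable ({y : Euc d | ‖y‖ ≤ 1}.indicator fun _ => (1 : ℂ)) :=
    measurable_const.indicator hs
  fun_prop

lemma norm_levyIntegrand_le (z x : Euc d) :
    ‖levyIntegrand z x‖ ≤ (3 * ‖z‖ ^ 2 + 2) * min (‖x‖ ^ 2) 1 := by
  unfold levyIntegrand
  rcases le_or_gt ‖x‖ 1 with h | h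
  · rw [Set.indicator_of_mem (by exact h), mul_one, min_eq_left (pow_le_one₀ (norm_nonneg _) h)]
    have h1 := Complex.norm_exp_I_mul_sub_one_sub_le (inner ℝ z x)
    have h2 : (inner ℝ z x : ℝ) ^ 2 ≤ (‖z‖ * ‖x‖) ^ 2 := by
      rw [← sq_abs]
      exact pow_le_pow_left₀ (abs_nonneg _) (abs_real_inner_le_norm z x) 2
    nlinarith [sq_nonneg ‖x‖]
  · rw [Set.indicator_of_notMem (by simpa using h), mul_zero, sub_zero,
      min_eq_right (one_le_pow₀ h.le)]
    have h1 := norm_sub_le (Complex.exp (Complex.I * (inner ℝ z x : ℝ))) 1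
    rw [Complex.norm_exp_I_mul_ofReal, norm_one] at h1
    nlinarith [sq_nonneg ‖z‖]

lemma IsLevyMeasure.integrable_min {ν : Measure (Euc d)} (h : IsLevyMeasure ν) :
    Integrable (fun x : Euc d => min (‖x‖ ^ 2) 1) ν := by
  refine ⟨by fun_prop, ?_⟩
  rw [hasFiniteIntegral_iff_ofReal (ae_of_all _ fun x => by positivity)]
  exact h.2

lemma IsLevyMeasure.integrable_levyIntegrand {ν : Measure (Euc d)} (h : IsLevyMeasure ν)
    (z : Euc d) : Integrable (levyIntegrand z) ν :=
  (h.integrable_min.const_mul (3 * ‖z‖ ^ 2 + 2)).mono'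
    (measurable_levyIntegrand z).aestronglyMeasurable (ae_of_all _ (norm_levyIntegrand_le z))

/-- The compensator is integrable on its own here, so it can be split off; it accounts for the gap
`∫_{|x| ≤ 1} x dν` between location and drift. -/
lemma integral_exp_inner_sub_one_eq {ν : Measure (Euc d)} (h : IsLevyMeasure ν)
    (hx : IntegrableOn (fun x : Euc d => x) {x | ‖x‖ ≤ 1} ν) (z : Euc d) :
    ∫ x, (Complex.exp (Complex.I * (inner ℝ z x : ℝ)) - 1) ∂ν
      = ∫ x, levyIntegrand z x ∂ν + Complex.I * (inner ℝ (∫ x in {x | ‖x‖ ≤ 1}, x ∂ν) z : ℝ) := by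
  have hs : MeasurableSet {y : Euc d | ‖y‖ ≤ 1} := measurableSet_le (by fun_prop) (by fun_prop)
  have hi : IntegrableOn (fun x : Euc d => Complex.I * ((inner ℝ z x : ℝ) : ℂ)) {x | ‖x‖ ≤ 1} ν :=
    (hx.const_inner z).ofReal.const_mul _
  have e : ∀ x : Euc d, Complex.exp (Complex.I * (inner ℝ z x : ℝ)) - 1 = levyIntegrand z x
      + {x : Euc d | ‖x‖ ≤ 1}.indicator (fun x => Complex.I * ((inner ℝ z x : ℝ) : ℂ)) x := by
    intro x
    unfold levyIntegrand
    by_cases hx : x ∈ {x : Euc d | ‖x‖ ≤ 1} <;> simp [hx]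
  simp_rw [e]
  rw [integral_add (h.integrable_levyIntegrand z) (hi.integrable_indicator hs),
    integral_indicator hs, integral_const_mul, integral_complex_ofReal,
    integral_inner hx, real_inner_comm]

lemma HasDriftRep.hasTriplet {μ : ProbabilityMeasure (Euc d)} {ν : Measure (Euc d)} {c : Euc d}
    (hμ : HasDriftRep μ ν c) (h : IsLevyMeasure ν)
    (hx : IntegrableOn (fun x : Euc d => x) {x | ‖x‖ ≤ 1} ν) :
    HasTriplet μ 0 ν (c + ∫ x in {x | ‖x‖ ≤ 1}, x ∂ν) := by
  refine ⟨Matrix.PosSemidef.zero, h, fun z => ?_⟩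
  rw [hμ z, integral_exp_inner_sub_one_eq h hx, inner_add_left]
  congr 1
  simp
  ring

lemma HasTriplet.charFun_eq {μ : ProbabilityMeasure (Euc d)} {ν : Measure (Euc d)} {γ : Euc d}
    (h : HasTriplet μ 0 ν γ) (z : Euc d) : charFun (μ : Measure (Euc d)) z =
      Complex.exp (∫ x, levyIntegrand z x ∂ν + Complex.I * (inner ℝ γ z : ℝ)) := by
  rw [h.2.2 z]
  simp

lemma HasTriplet.probabilityMeasure_eq {μ μ' : ProbabilityMeasure (Euc d)} {ν : Measure (Euc d)}
    {γ : Euc d} (h : HasTriplet μ 0 ν γ) (h' : HasTriplet μ' 0 ν γ) : μ = μ' := by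
  have : (μ : Measure (Euc d)) = μ' :=
    Measure.ext_of_charFun (funext fun z => (h.charFun_eq z).trans (h'.charFun_eq z).symm)
  exact Subtype.ext this

end LevyIntegrand

/-! ### Lévy measures carried by an annulus. -/

section Annulus

variable {d : ℕ}

lemma SupportedInAnnulus.ae_mem {ν : Measure (Euc d)} (h : SupportedInAnnulus ν) :
    ∃ a : ℝ, 1 < a ∧ ∀ᵐ x ∂ν, a⁻¹ ≤ ‖x‖ ∧ ‖x‖ ≤ a := by
  obtain ⟨a, ha, h1, h2⟩ := h
  refine ⟨a, ha, ?_⟩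
  have h1' : ∀ᵐ x ∂ν, ¬ ‖x‖ < a⁻¹ := by simpa [ae_iff] using h1
  have h2' : ∀ᵐ x ∂ν, ¬ a < ‖x‖ := by simpa [ae_iff] using h2
  filter_upwards [h1', h2'] with x h1 h2 using ⟨not_lt.1 h1, not_lt.1 h2⟩

lemma SupportedInAnnulus.integrable_id {ν : Measure (Euc d)} [IsFiniteMeasure ν]
    (h : SupportedInAnnulus ν) : Integrable (fun x : Euc d => x) ν := by
  obtain ⟨a, -, h⟩ := h.ae_mem
  exact (integrable_const a).mono' (by fun_prop) (h.mono fun x hx => hx.2)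

lemma SupportedInAnnulus.isLevyMeasure {ν : Measure (Euc d)} [IsFiniteMeasure ν]
    (h : SupportedInAnnulus ν) : IsLevyMeasure ν := by
  constructor
  · obtain ⟨a, ha, h1, -⟩ := h
    refine measure_mono_null ?_ h1
    rintro x rfl
    simpa using by positivity
  · calc ∫⁻ x, ENNReal.ofReal (min (‖x‖ ^ 2) 1) ∂ν ≤ ∫⁻ x, 1 ∂ν := by
          gcongr with x
          simp
      _ < ⊤ := by simp

lemma HasDriftRep.hasTriplet_of_supported {μ : ProbabilityMeasure (Euc d)} {ν : Measure (Euc d)}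
    [IsFiniteMeasure ν] {c : Euc d} (hμ : HasDriftRep μ ν c) (h : SupportedInAnnulus ν) :
    HasTriplet μ 0 ν (c + ∫ x in {x | ‖x‖ ≤ 1}, x ∂ν) :=
  hμ.hasTriplet h.isLevyMeasure h.integrable_id.integrableOn

/-- Every finite measure on an annulus is the Lévy measure of an element of `ID₀`. -/
lemma SupportedInAnnulus.exists_hasDriftRep {ν : Measure (Euc d)} [IsFiniteMeasure ν]
    (h : SupportedInAnnulus ν) (c : Euc d) :
    ∃ μ : ID0 d, HasDriftRep (μ.1 : Measure (Euc d)) ν c :=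
  ⟨⟨⟨shiftedCompoundPoisson ν c, inferInstance⟩,
    isInfinitelyDivisible_shiftedCompoundPoisson ν c, ν, _,
    HasDriftRep.hasTriplet_of_supported (hasDriftRep_shiftedCompoundPoisson ν c) h⟩,
    hasDriftRep_shiftedCompoundPoisson ν c⟩

/-- The characteristic function determines the law, so `μ` is the shifted compound Poisson law,
whose mean is known. -/
lemma HasDriftRep.hasMean {μ : ProbabilityMeasure (Euc d)} {ν : Measure (Euc d)}
    [IsFiniteMeasure ν] {c : Euc d} (hμ : HasDriftRep μ ν c) (h : SupportedInAnnulus ν) :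
    HasMean μ (c + ∫ x, x ∂ν) := by
  have e : μ = ⟨shiftedCompoundPoisson ν c, inferInstance⟩ :=
    Subtype.ext (hμ.measure_eq (hasDriftRep_shiftedCompoundPoisson ν c))
  rw [e]
  exact hasMean_shiftedCompoundPoisson c h.integrable_id

/-- Both sides are characteristic functions of Dirac masses, so no choice of logarithm is needed. -/
lemma eq_of_forall_exp_inner_eq {c c' : Euc d}
    (h : ∀ z : Euc d, Complex.exp (Complex.I * (inner ℝ c z : ℝ))
      = Complex.exp (Complex.I * (inner ℝ c' z : ℝ))) : c = c' := by
  have : (Measure.dirac c : Measure (Euc d)) = Measure.dirac c' := by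
    refine Measure.ext_of_charFun (funext fun z => ?_)
    rw [charFun_dirac, charFun_dirac, mul_comm, h, mul_comm]
  exact dirac_eq_dirac_iff.1 this

lemma eq_of_forall_exp_add_inner_eq {F : Euc d → ℂ} {c c' : Euc d}
    (h : ∀ z : Euc d, Complex.exp (F z + Complex.I * (inner ℝ c z : ℝ))
      = Complex.exp (F z + Complex.I * (inner ℝ c' z : ℝ))) : c = c' := by
  refine eq_of_forall_exp_inner_eq fun z => ?_
  have := h z
  rw [Complex.exp_add, Complex.exp_add] at this
  exact mul_left_cancel₀ (Complex.exp_ne_zero _) this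

end Annulus

/-! ### Inversion of Lévy measures. -/

section InvMeasure

variable {d : ℕ}

lemma measurable_geomInv : Measurable (geomInv (d := d)) := by
  unfold geomInv
  fun_prop

lemma norm_geomInv (x : Euc d) : ‖geomInv x‖ = ‖x‖⁻¹ := by
  rw [geomInv, norm_smul, norm_inv, norm_pow, norm_norm]
  rcases eq_or_ne ‖x‖ 0 with h | h
  · simp [h]
  · field_simp

/-- The weight `|x|²` exactly undoes the scaling of the inversion, which is why first moments
transform so simply. At the origin it holds because `geomInv 0 = 0`. -/
lemma norm_sq_smul_geomInv (x : Euc d) : ‖x‖ ^ 2 • geomInv x = x := by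
  rcases eq_or_ne x 0 with rfl | h
  · simp
  · rw [geomInv, smul_smul, mul_inv_cancel₀ (by simpa using h), one_smul]

/-- The image of `|x|² ν(dx)` on `ℝ^d \ {0}` under the geometric inversion. -/
noncomputable def invMeasure (ν : Measure (Euc d)) : Measure (Euc d) :=
  ((ν.restrict {0}ᶜ).withDensity fun x => ENNReal.ofReal (‖x‖ ^ 2)).map geomInv

lemma invMeasure_apply (ν : Measure (Euc d)) {B : Set (Euc d)} (hB : MeasurableSet B) :
    invMeasure ν B = ∫⁻ x in ({0}ᶜ : Set (Euc d)),
      B.indicator (fun _ => (1 : ENNReal)) (geomInv x) * ENNReal.ofReal (‖x‖ ^ 2) ∂ν := by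
  rw [invMeasure, Measure.map_apply measurable_geomInv hB,
    withDensity_apply _ (measurable_geomInv hB), ← lintegral_indicator (measurable_geomInv hB)]
  refine lintegral_congr fun x => ?_
  by_cases hx : geomInv x ∈ B
  · rw [Set.indicator_of_mem (by exact hx), Set.indicator_of_mem hx, one_mul]
  · rw [Set.indicator_of_notMem (by exact hx), Set.indicator_of_notMem hx, zero_mul]

/-- Condition 1 thus names the Lévy measure of the image outright, so uniqueness of triplets is
never invoked. -/
lemma isInvertedMeasure_iff {ν ν' : Measure (Euc d)} :
    IsInvertedMeasure ν ν' ↔ ν' = invMeasure ν := by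
  constructor
  · intro h
    ext B hB
    rw [h B hB, invMeasure_apply ν hB]
  · rintro rfl B hB
    exact invMeasure_apply ν hB

@[simp]
lemma invMeasure_zero : invMeasure (0 : Measure (Euc d)) = 0 := by simp [invMeasure]

lemma invMeasure_dirac {e : Euc d} (he : ‖e‖ = 1) :
    invMeasure (Measure.dirac e) = Measure.dirac e := by
  have h0 : e ∈ ({0}ᶜ : Set (Euc d)) := by
    rintro rfl
    simp at he
  have hi : geomInv e = e := by simp [geomInv, he]
  ext B hB
  have : Measurable fun x : Euc d =>
      B.indicator (fun _ => (1 : ENNReal)) (geomInv x) * ENNReal.ofReal (‖x‖ ^ 2) :=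
    ((measurable_const.indicator hB).comp measurable_geomInv).mul (by fun_prop)
  classical
  rw [invMeasure_apply _ hB, restrict_dirac' (by measurability), if_pos h0,
    lintegral_dirac' _ this, hi, he, Measure.dirac_apply' _ hB]
  simp [Set.indicator]

lemma invMeasure_restrict (ν : Measure (Euc d)) {A : Set (Euc d)} (hA : MeasurableSet A)
    (h : ∀ x, x ≠ 0 → (geomInv x ∈ A ↔ x ∈ A)) :
    invMeasure (ν.restrict A) = (invMeasure ν).restrict A := by
  have h0 : MeasurableSet ({0}ᶜ : Set (Euc d)) := by measurability
  rw [invMeasure, invMeasure, Measure.restrict_map measurable_geomInv hA,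
    restrict_withDensity (measurable_geomInv hA), Measure.restrict_restrict h0,
    Measure.restrict_restrict (measurable_geomInv hA)]
  have : {0}ᶜ ∩ A = geomInv ⁻¹' A ∩ {0}ᶜ := by
    ext x
    simp only [Set.mem_inter_iff, Set.mem_compl_iff, Set.mem_singleton_iff, Set.mem_preimage]
    constructor
    · exact fun hx => ⟨(h x hx.1).2 hx.2, hx.1⟩
    · exact fun hx => ⟨hx.2, (h x hx.2).1 hx.1⟩
  rw [this]

lemma setIntegral_id_invMeasure {ν : Measure (Euc d)} (h0 : ν {0} = 0) {S : Set (Euc d)}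
    (hS : MeasurableSet S) :
    ∫ x in S, x ∂(invMeasure ν) = ∫ x in geomInv ⁻¹' S, x ∂ν := by
  have hr : ν.restrict {0}ᶜ = ν := Measure.restrict_eq_self_of_ae_mem (by simpa [ae_iff] using h0)
  rw [invMeasure, hr, Measure.restrict_map measurable_geomInv hS,
    restrict_withDensity (measurable_geomInv hS),
    integral_map measurable_geomInv.aemeasurable (by fun_prop),
    integral_withDensity_eq_integral_toReal_smul (by fun_prop) (by simp)]
  refine integral_congr_ae (ae_of_all _ fun x => ?_)
  simp only
  rw [ENNReal.toReal_ofReal (by positivity), norm_sq_smul_geomInv]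

lemma SupportedInAnnulus.invMeasure {ν : Measure (Euc d)} (h : SupportedInAnnulus ν) :
    SupportedInAnnulus (invMeasure ν) := by
  obtain ⟨a, ha, h1, h2⟩ := h
  have ha0 : 0 < a := by positivity
  have key : ∀ B : Set (Euc d), MeasurableSet B → ν (geomInv ⁻¹' B ∩ {0}ᶜ) = 0 →
      _root_.invMeasure ν B = 0 := by
    intro B hB h
    rw [_root_.invMeasure, Measure.map_apply measurable_geomInv hB]
    refine withDensity_absolutelyContinuous _ _ ?_
    rw [Measure.restrict_apply (measurable_geomInv hB), h]
  refine ⟨a, ha, key _ (measurableSet_lt (by fun_prop) (by fun_prop)) (measure_mono_null ?_ h2),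
    key _ (measurableSet_lt (by fun_prop) (by fun_prop)) (measure_mono_null ?_ h1)⟩
  · rintro x ⟨hx, hx0⟩
    have hn : 0 < ‖x‖ := norm_pos_iff.2 hx0
    simpa [norm_geomInv, inv_lt_inv₀ hn ha0] using hx
  · rintro x ⟨hx, hx0⟩
    have hn : 0 < ‖x‖ := norm_pos_iff.2 hx0
    have hx : a < ‖x‖⁻¹ := by simpa [norm_geomInv] using hx
    exact (lt_inv_comm₀ ha0 hn).1 hx

lemma SupportedInAnnulus.isFiniteMeasure_invMeasure {ν : Measure (Euc d)} [IsFiniteMeasure ν]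
    (h : SupportedInAnnulus ν) : IsFiniteMeasure (_root_.invMeasure ν) := by
  obtain ⟨a, ha, hae⟩ := h.ae_mem
  have ha0 : 0 < a := by positivity
  refine ⟨?_⟩
  rw [_root_.invMeasure, Measure.map_apply measurable_geomInv .univ, Set.preimage_univ,
    withDensity_apply _ .univ, Measure.restrict_univ]
  calc ∫⁻ x in {0}ᶜ, ENNReal.ofReal (‖x‖ ^ 2) ∂ν
      ≤ ∫⁻ x, ENNReal.ofReal (‖x‖ ^ 2) ∂ν := setLIntegral_le_lintegral _ _
    _ ≤ ∫⁻ x, ENNReal.ofReal (a ^ 2) ∂ν := by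
        refine lintegral_mono_ae (hae.mono fun x hx => ?_)
        gcongr
        exact hx.2
    _ < ⊤ := by
        rw [lintegral_const]
        exact ENNReal.mul_lt_top ENNReal.ofReal_lt_top (measure_lt_top _ _)

/-- Away from the origin the preimage of the closed unit ball is `{|x| ≥ 1}`, so the two domains
cover the space and overlap in the unit sphere. This overlap is the source of the sphere term in the
location of the inversion. -/
lemma SupportedInAnnulus.setIntegral_norm_le_one_add {ν : Measure (Euc d)} [IsFiniteMeasure ν]
    (h : SupportedInAnnulus ν) :
    ∫ x in {x | ‖x‖ ≤ 1}, x ∂ν + ∫ x in geomInv ⁻¹' {x | ‖x‖ ≤ 1}, x ∂ν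
      = ∫ x, x ∂ν + ∫ x in {x | ‖x‖ = 1}, x ∂ν := by
  have heq : MeasurableSet {x : Euc d | ‖x‖ = 1} := measurableSet_eq_fun (by fun_prop) (by fun_prop)
  have hlt : MeasurableSet {x : Euc d | ‖x‖ < 1} := measurableSet_lt (by fun_prop) (by fun_prop)
  have hi := h.integrable_id
  have hle : {x : Euc d | ‖x‖ ≤ 1} = {x | ‖x‖ < 1} ∪ {x | ‖x‖ = 1} := by
    ext x
    exact le_iff_lt_or_eq (a := ‖x‖) (b := 1)
  have hdisj : Disjoint {x : Euc d | ‖x‖ < 1} {x | ‖x‖ = 1} :=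
    Set.disjoint_left.2 fun x hx hx' => ne_of_lt hx hx'
  -- Equality is only almost sure: `geomInv 0 = 0` puts the origin in the preimage.
  have hge : (geomInv ⁻¹' {x : Euc d | ‖x‖ ≤ 1} : Set (Euc d)) =ᵐ[ν] ({x | ‖x‖ < 1}ᶜ : Set _) := by
    have : ∀ᵐ x ∂ν, x ≠ 0 := by simpa [ae_iff] using h.isLevyMeasure.1
    refine eventuallyEq_set.2 (this.mono fun x hx => ?_)
    have hn : 0 < ‖x‖ := norm_pos_iff.2 hx
    simp only [Set.mem_preimage, Set.mem_ofPred_eq, norm_geomInv, Set.mem_compl_iff, not_lt]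
    exact inv_le_one₀ hn
  rw [setIntegral_congr_set hge, hle, setIntegral_union hdisj heq hi.integrableOn hi.integrableOn,
    ← integral_add_compl hlt hi]
  abel

end InvMeasure

/-! ### Exhaustion by annuli stable under inversion. -/

section NormAnnulus

variable {d : ℕ}

/-- The annuli `{1/(n+2) ≤ |x| ≤ n+2}`, which exhaust `ℝ^d \ {0}`. -/
def normAnnulus (d n : ℕ) : Set (Euc d) := {x | ((n : ℝ) + 2)⁻¹ ≤ ‖x‖ ∧ ‖x‖ ≤ (n : ℝ) + 2}

lemma measurableSet_normAnnulus (n : ℕ) : MeasurableSet (normAnnulus d n) := by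
  unfold normAnnulus
  exact (measurableSet_le measurable_const measurable_norm).inter
    (measurableSet_le measurable_norm measurable_const)

lemma geomInv_mem_normAnnulus_iff (n : ℕ) {x : Euc d} (hx : x ≠ 0) :
    geomInv x ∈ normAnnulus d n ↔ x ∈ normAnnulus d n := by
  have hn : 0 < ‖x‖ := norm_pos_iff.2 hx
  have h2 : (0 : ℝ) < n + 2 := by positivity
  simp only [normAnnulus, Set.mem_ofPred_eq, norm_geomInv]
  rw [inv_le_inv₀ h2 hn, inv_le_comm₀ hn h2, and_comm]

lemma mem_normAnnulus_of_norm_eq_one (n : ℕ) {x : Euc d} (hx : ‖x‖ = 1) :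
    x ∈ normAnnulus d n := by
  have hn : (0 : ℝ) ≤ n := by positivity
  exact ⟨by rw [hx]; exact inv_le_one_of_one_le₀ (by linarith), by rw [hx]; linarith⟩

lemma supportedInAnnulus_restrict_normAnnulus (ν : Measure (Euc d)) (n : ℕ) :
    SupportedInAnnulus (ν.restrict (normAnnulus d n)) := by
  have hn : (0 : ℝ) ≤ n := by positivity
  -- The shift by `2` keeps the radius above `1` even for `n = 0`.
  refine ⟨n + 2, by linarith, ?_, ?_⟩
  · rw [Measure.restrict_apply (measurableSet_lt (by fun_prop) (by fun_prop)),
      show {x : Euc d | ‖x‖ < ((n : ℝ) + 2)⁻¹} ∩ normAnnulus d n = ∅ from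
        Set.eq_empty_of_forall_notMem fun x hx => absurd hx.1 (not_lt.2 hx.2.1), measure_empty]
  · rw [Measure.restrict_apply (measurableSet_lt (by fun_prop) (by fun_prop)),
      show {x : Euc d | (n : ℝ) + 2 < ‖x‖} ∩ normAnnulus d n = ∅ from
        Set.eq_empty_of_forall_notMem fun x hx => absurd hx.1 (not_lt.2 hx.2.2), measure_empty]

lemma IsLevyMeasure.isFiniteMeasure_restrict_normAnnulus {ν : Measure (Euc d)}
    (h : IsLevyMeasure ν) (n : ℕ) : IsFiniteMeasure (ν.restrict (normAnnulus d n)) := by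
  have hpos : (0 : ℝ) < (((n : ℝ) + 2)⁻¹) ^ 2 := by positivity
  have hlt := h.integrable_min.measure_ge_lt_top hpos
  refine ⟨?_⟩
  rw [Measure.restrict_apply_univ]
  refine (measure_mono fun x hx => ?_).trans_lt hlt
  have hn : (0 : ℝ) ≤ n := by positivity
  refine le_min (pow_le_pow_left₀ (by positivity) hx.1 2) (pow_le_one₀ (by positivity) ?_)
  exact inv_le_one_of_one_le₀ (by linarith)

lemma aecover_normAnnulus {ν : Measure (Euc d)} (h0 : ν {0} = 0) :
    AECover ν atTop (normAnnulus d) where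
  ae_eventually_mem := by
    have : ∀ᵐ x ∂ν, x ≠ 0 := by simpa [ae_iff] using h0
    filter_upwards [this] with x hx
    have hn : 0 < ‖x‖ := norm_pos_iff.2 hx
    have h1 : Tendsto (fun n : ℕ => (n : ℝ) + 2) atTop atTop :=
      tendsto_atTop_add_const_right _ _ tendsto_natCast_atTop_atTop
    filter_upwards [h1.eventually_ge_atTop ‖x‖, h1.eventually_ge_atTop ‖x‖⁻¹] with n ha hb
    exact ⟨inv_le_of_inv_le₀ hn hb, ha⟩
  measurableSet := measurableSet_normAnnulus

lemma IsLevyMeasure.tendsto_integral_levyIntegrand {ν : Measure (Euc d)} (h : IsLevyMeasure ν)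
    (z : Euc d) : Tendsto (fun n => ∫ x in normAnnulus d n, levyIntegrand z x ∂ν) atTop
      (𝓝 (∫ x, levyIntegrand z x ∂ν)) :=
  (aecover_normAnnulus h.1).integral_tendsto_of_countably_generated
    (h.integrable_levyIntegrand z)

end NormAnnulus

/-! ### Determination of `k` and of the location. -/

section Sharp

variable {d : ℕ} {sharp : ID0 d → ID0 d} {k : ℝ}

/-- The drift hypothesis provides some Lévy measure; converting its representation into a triplet
lets `h_levy` identify that measure as `invMeasure ν`. -/
lemma hasDriftRep_sharp
    (h_levy : ∀ (μ : ID0 d) (ν ν' : Measure (Euc d)) (γ γ' : Euc d),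
      HasTriplet μ.1 0 ν γ → HasTriplet (sharp μ).1 0 ν' γ' → IsInvertedMeasure ν ν')
    (h_drift : ∀ μ : ID0 d, μ.1 ∈ ID0c d →
      ∀ m : Euc d, HasMean μ.1 m → HasDrift (sharp μ) (k • m))
    {μ : ID0 d} {ν : Measure (Euc d)} [IsFiniteMeasure ν] {c : Euc d}
    (hν : SupportedInAnnulus ν) (hμ : HasDriftRep (μ.1 : Measure (Euc d)) ν c) :
    HasDriftRep ((sharp μ).1 : Measure (Euc d)) (invMeasure ν) (k • (c + ∫ x, x ∂ν)) := by
  have ht := hμ.hasTriplet_of_supported hν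
  obtain ⟨ν', hν', hx, hrep⟩ := h_drift μ ⟨μ.2, ν, _, ht, hν⟩ _ (hμ.hasMean hν)
  have hrep : HasDriftRep ((sharp μ).1 : Measure (Euc d)) ν' (k • (c + ∫ x, x ∂ν)) := hrep
  have hx' : IntegrableOn (fun x : Euc d => x) {x | ‖x‖ ≤ 1} ν' :=
    ⟨by fun_prop, by simpa only [hasFiniteIntegral_iff_norm] using hx⟩
  rwa [← isInvertedMeasure_iff.1 (h_levy μ ν ν' _ _ ht (hrep.hasTriplet hν' hx'))]

lemma drift_constant_eq_neg_one (hd : 1 ≤ d)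
    (h_levy : ∀ (μ : ID0 d) (ν ν' : Measure (Euc d)) (γ γ' : Euc d),
      HasTriplet μ.1 0 ν γ → HasTriplet (sharp μ).1 0 ν' γ' → IsInvertedMeasure ν ν')
    (h_invol : ∀ μ : ID0 d, sharp (sharp μ) = μ)
    (h_drift : ∀ μ : ID0 d, μ.1 ∈ ID0c d →
      ∀ m : Euc d, HasMean μ.1 m → HasDrift (sharp μ) (k • m)) : k = -1 := by
  obtain ⟨e, he⟩ : ∃ e : Euc d, ‖e‖ = 1 := ⟨EuclideanSpace.single ⟨0, hd⟩ 1, by simp⟩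
  have he0 : e ≠ 0 := by
    rintro rfl
    simp at he
  have h0 : SupportedInAnnulus (0 : Measure (Euc d)) := ⟨2, by norm_num, by simp, by simp⟩
  have h1 : SupportedInAnnulus (Measure.dirac e) := by
    refine ⟨2, by norm_num, ?_, ?_⟩
    · rw [Measure.dirac_apply' _ (measurableSet_lt (by fun_prop) (by fun_prop))]
      simp only [Set.indicator_apply_eq_zero, Set.mem_ofPred_eq, he]
      norm_num
    · rw [Measure.dirac_apply' _ (measurableSet_lt (by fun_prop) (by fun_prop))]
      simp only [Set.indicator_apply_eq_zero, Set.mem_ofPred_eq, he]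
      norm_num
  -- On a self-inverse `ν` the map acts on drifts alone, by `c ↦ k • (c + ∫ x dν)`, and its square
  -- must fix every `c`.
  have key : ∀ (ν : Measure (Euc d)) [IsFiniteMeasure ν] (c : Euc d), SupportedInAnnulus ν →
      invMeasure ν = ν → c = k • (k • (c + ∫ x, x ∂ν) + ∫ x, x ∂ν) := by
    intro ν _ c hν hinv
    obtain ⟨μ, hμ⟩ := hν.exists_hasDriftRep c
    have hs := hasDriftRep_sharp h_levy h_drift hν hμ
    rw [hinv] at hs
    have hss := hasDriftRep_sharp h_levy h_drift hν hs
    rw [hinv, h_invol] at hss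
    exact eq_of_forall_exp_add_inner_eq fun z => (hμ z).symm.trans (hss z)
  have k0 := key 0 e h0 invMeasure_zero
  have k1 := key (Measure.dirac e) 0 h1 (invMeasure_dirac he)
  simp only [integral_zero_measure, add_zero, integral_dirac, zero_add] at k0 k1
  have e0 : k * k = 1 := by
    have : (k * k - 1) • e = 0 := by rw [sub_smul, mul_smul, ← k0, one_smul, sub_self]
    linarith [(smul_eq_zero.1 this).resolve_right he0]
  have e1 : k * (k + 1) = 0 := by
    have : (k * (k + 1)) • e = 0 := by rw [mul_smul, add_smul, one_smul, ← k1]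
    exact (smul_eq_zero.1 this).resolve_right he0
  linarith

lemma location_sharp
    (h_levy : ∀ (μ : ID0 d) (ν ν' : Measure (Euc d)) (γ γ' : Euc d),
      HasTriplet μ.1 0 ν γ → HasTriplet (sharp μ).1 0 ν' γ' → IsInvertedMeasure ν ν')
    (h_drift : ∀ μ : ID0 d, μ.1 ∈ ID0c d →
      ∀ m : Euc d, HasMean μ.1 m → HasDrift (sharp μ) ((-1 : ℝ) • m))
    (h_cont : ∀ (μ : ID0 d) (μs : ℕ → ID0 d),
      Tendsto (fun n => (μs n).1) atTop (𝓝 μ.1) →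
        Tendsto (fun n => (sharp (μs n)).1) atTop (𝓝 (sharp μ).1))
    {μ : ID0 d} {ν ν' : Measure (Euc d)} {γ γ' : Euc d} (hμ : HasTriplet μ.1 0 ν γ)
    (hs : HasTriplet (sharp μ).1 0 ν' γ') :
    γ' = -γ + ∫ x in {x : Euc d | ‖x‖ = 1}, x ∂ν := by
  obtain rfl := isInvertedMeasure_iff.1 (h_levy μ ν ν' γ γ' hμ hs)
  have hν := hμ.2.1
  have hfin := hν.isFiniteMeasure_restrict_normAnnulus
  have hsupp := supportedInAnnulus_restrict_normAnnulus ν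
  have hle : MeasurableSet {x : Euc d | ‖x‖ ≤ 1} := measurableSet_le (by fun_prop) (by fun_prop)
  have heq : MeasurableSet {x : Euc d | ‖x‖ = 1} := measurableSet_eq_fun (by fun_prop) (by fun_prop)
  -- This drift makes the location equal to `γ` for every `n`.
  choose μs hμs using fun n => (hsupp n).exists_hasDriftRep
    (γ - ∫ x in {x | ‖x‖ ≤ 1}, x ∂(ν.restrict (normAnnulus d n)))
  have htrip : ∀ n, HasTriplet (μs n).1 0 (ν.restrict (normAnnulus d n)) γ := fun n => by
    simpa using (hμs n).hasTriplet_of_supported (hsupp n)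
  have hconv : Tendsto (fun n => (μs n).1) atTop (𝓝 μ.1) := by
    refine ProbabilityMeasure.tendsto_iff_tendsto_charFun.2 fun z => ?_
    simp_rw [(htrip _).charFun_eq z, hμ.charFun_eq z]
    exact ((hν.tendsto_integral_levyIntegrand z).add_const _).cexp
  have hconv' := h_cont μ μs hconv
  -- The location of the images does not depend on `n`, since every annulus contains the unit
  -- sphere.
  have htrip' : ∀ n, HasTriplet (sharp (μs n)).1 0 ((invMeasure ν).restrict (normAnnulus d n))
      (-γ + ∫ x in {x : Euc d | ‖x‖ = 1}, x ∂ν) := fun n => by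
    have := (hsupp n).isFiniteMeasure_invMeasure
    have h := (hasDriftRep_sharp h_levy h_drift (hsupp n) (hμs n)).hasTriplet_of_supported
      (hsupp n).invMeasure
    rw [setIntegral_id_invMeasure (hsupp n).isLevyMeasure.1 hle,
      invMeasure_restrict ν (measurableSet_normAnnulus n)
        (fun x hx => geomInv_mem_normAnnulus_iff n hx)] at h
    have hone : ∫ x in {x : Euc d | ‖x‖ = 1}, x ∂(ν.restrict (normAnnulus d n))
        = ∫ x in {x : Euc d | ‖x‖ = 1}, x ∂ν := by
      have hsub : {x : Euc d | ‖x‖ = 1} ⊆ normAnnulus d n := fun x hx =>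
        mem_normAnnulus_of_norm_eq_one n hx
      rw [Measure.restrict_restrict heq, Set.inter_eq_left.2 hsub]
    convert h using 1
    have hsplit := (hsupp n).setIntegral_norm_le_one_add
    rw [hone] at hsplit
    rw [neg_one_smul, eq_sub_of_add_eq' hsplit]
    abel
  have hinv := hs.2.1
  -- The law `sharp μ` and the limit of the images share the Lévy measure `invMeasure ν`, so equal
  -- characteristic functions force equal locations.
  refine eq_of_forall_exp_add_inner_eq fun z => (hs.charFun_eq z).symm.trans ?_
  refine tendsto_nhds_unique (ProbabilityMeasure.tendsto_iff_tendsto_charFun.1 hconv' z) ?_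
  simp_rw [(htrip' _).charFun_eq z]
  exact ((hinv.tendsto_integral_levyIntegrand z).add_const _).cexp

end Sharp

theorem proposition2p3 (d : ℕ) (hd : 1 ≤ d) (sharp : ID0 d → ID0 d)
    (h_levy : ∀ (μ : ID0 d) (ν ν' : Measure (Euc d)) (γ γ' : Euc d),
      HasTriplet μ.1 0 ν γ → HasTriplet (sharp μ).1 0 ν' γ' → IsInvertedMeasure ν ν')
    (h_invol : ∀ μ : ID0 d, sharp (sharp μ) = μ)
    (k : ℝ)
    (h_drift : ∀ μ : ID0 d, μ.1 ∈ ID0c d →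
      ∀ m : Euc d, HasMean μ.1 m → HasDrift (sharp μ) (k • m))
    (h_cont : ∀ (μ : ID0 d) (μs : ℕ → ID0 d),
      Tendsto (fun n => (μs n).1) atTop (𝓝 μ.1) →
        Tendsto (fun n => (sharp (μs n)).1) atTop (𝓝 (sharp μ).1)) :
    k = -1 ∧ ∀ μ ρ : ID0 d, IsInversion μ ρ ↔ ρ = sharp μ := by
  obtain rfl := drift_constant_eq_neg_one hd h_levy h_invol h_drift
  refine ⟨rfl, fun μ ρ => ⟨fun h => ?_, ?_⟩⟩
  · obtain ⟨ν, γ, hμ⟩ := μ.2.2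
    obtain ⟨νr, γr, hρ⟩ := ρ.2.2
    obtain ⟨νs, γs, hs⟩ := (sharp μ).2.2
    obtain ⟨hν, hγ⟩ := h ν νr γ γr hμ hρ
    have hν' := h_levy μ ν νs γ γs hμ hs
    rw [isInvertedMeasure_iff] at hν hν'
    have hγ' := location_sharp h_levy h_drift h_cont hμ hs
    -- The triplet of `ρ` becomes that of `sharp μ`.
    rw [hν, hγ, ← hν', ← hγ'] at hρ
    exact Subtype.ext (hρ.probabilityMeasure_eq hs)
  · rintro rfl ν ν' γ γ' hμ hs
    exact ⟨h_levy μ ν ν' γ γ' hμ hs, location_sharp h_levy h_drift h_cont hμ hs⟩
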